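/- Let $W$ be the group of linear automorphisms of $\mathbb{R}^4$ generated by $\sigma_1,\sigma_2,\sigma_3,\sigma_4$, where $\sigma_i$ replaces the coordinate $s_i$ of $\mathbf{s}=(s_1,s_2,s_3,s_4)$ by $-s_i$ and replaces $s_j$ by $s_j+2s_i$ for every $j\neq i$. (This is the Weyl group of the root system with Cartan matrix $(\alpha_i,\alpha_i)=2$, $(\alpha_i,\alpha_j)=-2$ for $i\ne j$; the $s_i=(\mathbf{s},\alpha_i)$ are coordinates in the basis of fundamental weights.) Let $C\subset\mathbb{R}^4$ be the set of points with all $s_i\ge 0$ and at most one $s_i=0$, and let $A=\bigcup_{w\in W}w(C)$ be the (real) Apollonian cone. The 2-skeleton of $A$ is the union, over $w\in W$, of the images under $w$ of the faces of dimension at most $2$ of the simplicial cone $\{\mathbf{s}: s_1,s_2,s_3,s_4\ge 0\}$, that is, of the set of points with all $s_i\ge0$ and at least two $s_i=0$. Let $B$ be the set of points $\mathbf{s}\in\mathbb{R}^4$ such that, for every $w\in W$, the point $w(\mathbf{s})$ has exactly three positive coordinates and one negative coordinate. **Proposition.** Let $\mathbf{s}$ be a point of the topological boundary $\partial A$ which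 is not in the 2-skeleton of $A$. Then every $W$-translate of $\mathbf{s}$ has exactly three positive coordinates and one negative. Thus $$B=\partial A\setminus(\text{2-skeleton of }A).$$ Both assertions hold in $\mathbb{R}^4$. They also hold in $\mathbb{RP}^3$: there $A$, its 2-skeleton and $B$ are replaced by the sets of lines spanned by their nonzero vectors, the boundary is taken in $\mathbb{RP}^3$, and a point of $\mathbb{RP}^3$ is represented by any nonzero vector $\mathbf{s}$ on the line with $s_1+s_2+s_3+s_4\ge 0$. -/

import Mathlib

open scoped LinearAlgebra.Projectivization

namespace Apollonian

/-- The Cartan matrix of the root system: the Gram matrix `(α i, α j)` of the simple roots. -/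
def cartan : Matrix (Fin 4) (Fin 4) ℝ := fun i j => if i = j then 2 else -2

/-- The space `ℝ⁴`. A vector `s` stands for `s 0 • ω₁ + s 1 • ω₂ + s 2 • ω₃ + s 3 • ω₄`, where the
fundamental weights `ωᵢ` are dual to the simple roots; so the coordinates of `s` are the numbers
`s i = (s, α i)`. -/
abbrev V : Type := Fin 4 → ℝ

/-- The simple root `α i` in the basis of fundamental weights: `α i = ∑ j, (α i, α j) ω j`. -/
def simpleRoot (i : Fin 4) : V := fun j => cartan i j

/-- The linear form `s ↦ (s, α i)`, which is the `i`-th coordinate. -/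
def pairing (i : Fin 4) : Module.Dual ℝ V := LinearMap.proj i

theorem pairing_simpleRoot (i : Fin 4) : pairing i (simpleRoot i) = 2 := by
  simp [pairing, simpleRoot, cartan]

/-- The simple reflection `σ i : s ↦ s - (s, α i) α i`. -/
def sigma (i : Fin 4) : V ≃ₗ[ℝ] V := Module.reflection (pairing_simpleRoot i)

/-- In coordinates, `σ i` negates `s i` and adds `2 * s i` to every other coordinate. -/
theorem sigma_apply (i : Fin 4) (s : V) (j : Fin 4) :
    sigma i s j = if j = i then -s i else s j + 2 * s i := by
  by_cases h : j = i
  · subst h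
    simp [sigma, Module.reflection_apply, pairing, simpleRoot, cartan]
    ring
  · have h' : ¬ i = j := fun e => h e.symm
    simp [sigma, Module.reflection_apply, pairing, simpleRoot, cartan, h, h']
    ring

/-- The action on simple roots: `σ i (α j) = α j - (α j, α i) α i`. -/
theorem sigma_simpleRoot (i j : Fin 4) :
    sigma i (simpleRoot j) = simpleRoot j - cartan j i • simpleRoot i := by
  simp [sigma, Module.reflection_apply, pairing, simpleRoot]

/-- The Weyl group (Apollonian group) `W`, generated by the simple reflections, as a group of
linear automorphisms of `ℝ⁴`. -/
def W : Subgroup (V ≃ₗ[ℝ] V) := Subgroup.closure (Set.range sigma)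

/-- The union `⋃ w ∈ W, w(S)` of the `W`-translates of a set `S`. -/
def translates (S : Set V) : Set V := ⋃ w ∈ W, (fun s => w s) '' S

/-- The region `C`: all coordinates are nonnegative and at most one of them is zero. -/
def C : Set V := {s | (∀ i, 0 ≤ s i) ∧ ∀ i j, s i = 0 → s j = 0 → i = j}

/-- The Apollonian cone `A`, the union of all `w(C)` (real part). -/
def A : Set V := translates C

/-- The `2`-skeleton of the closed simplicial cone `{s | ∀ i, 0 ≤ s i}`: the union of its faces
of dimension at most two, that is, at least two coordinates are zero. -/
def baseTwoSkeleton : Set V := {s | (∀ i, 0 ≤ s i) ∧ ∃ i j, i ≠ j ∧ s i = 0 ∧ s j = 0}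

/-- The `2`-skeleton of `A`: the union of the `2`-skeletons of all the simplicial cones into
which `A` is divided by `W`. -/
def twoSkeleton : Set V := translates baseTwoSkeleton

/-- Exactly three coordinates are positive and one is negative. -/
def ThreePosOneNeg (s : V) : Prop := ∃ i, s i < 0 ∧ ∀ j, j ≠ i → 0 < s j

/-- The set `B` of points all of whose `W`-translates have exactly three positive coordinates and
one negative coordinate. -/
def B : Set V := {s | ∀ w ∈ W, ThreePosOneNeg (w s)}

/-- Real projective `3`-space. -/
abbrev RP3 : Type := ℙ ℝ V

/-- The quotient topology on projective space. -/
noncomputable instance : TopologicalSpace RP3 :=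
  TopologicalSpace.coinduced (Projectivization.mk' ℝ : {v : V // v ≠ 0} → RP3) inferInstance

/-- The subset of projective space given by a cone `S` in `ℝ⁴`: the lines spanned by the nonzero
vectors of `S`. -/
def proj (S : Set V) : Set RP3 := {p | ∃ (v : V) (hv : v ≠ 0), v ∈ S ∧ Projectivization.mk ℝ v hv = p}

end Apollonian

namespace Apollonian

/-! Everything is compared with the Tits cone, which is `A` together with its 2-skeleton. It lies in
the closed cone `pairCone`, so `closure A` does too. A boundary point off the 2-skeleton is outside
the Tits cone, so each translate has a negative coordinate `s i`, and `s i + s j ≥ 0` makes the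
others positive. Conversely, a point of `B` lies outside the Tits cone, and all its translates have
nonnegative height (`sum_nonneg_of_mem_B`). Adding `δ • rho` puts it in the Tits cone: an endless
descent would not raise the height of the sum, while that of the translates of `rho` grows without
bound. Hence `B` lies in `closure A`, and `A` is open. For `ℝP³`: `pairCone` meets its negative only
in `0`. -/

theorem mem_translates {S : Set V} {t : V} :
    t ∈ translates S ↔ ∃ w ∈ W, ∃ s ∈ S, w s = t := by
  simp [translates]

theorem subset_translates (S : Set V) : S ⊆ translates S := fun s hs =>
  mem_translates.2 ⟨1, W.one_mem, s, hs, rfl⟩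

theorem translates_mono {S S' : Set V} (h : S ⊆ S') : translates S ⊆ translates S' := by
  intro t ht
  obtain ⟨w, hw, s, hs, rfl⟩ := mem_translates.1 ht
  exact mem_translates.2 ⟨w, hw, s, h hs, rfl⟩

theorem apply_mem_translates {S : Set V} {t : V} {w : V ≃ₗ[ℝ] V} (hw : w ∈ W)
    (ht : t ∈ translates S) : w t ∈ translates S := by
  obtain ⟨u, hu, s, hs, rfl⟩ := mem_translates.1 ht
  exact mem_translates.2 ⟨w * u, W.mul_mem hw hu, s, hs, rfl⟩

theorem inv_apply_apply (w : V ≃ₗ[ℝ] V) (s : V) : w⁻¹ (w s) = s := w.symm_apply_apply s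

theorem mem_translates_of_apply {S : Set V} {t : V} {w : V ≃ₗ[ℝ] V} (hw : w ∈ W)
    (ht : w t ∈ translates S) : t ∈ translates S := by
  have := apply_mem_translates (W.inv_mem hw) ht
  rwa [inv_apply_apply] at this

theorem smul_mem_translates {S : Set V} (hS : ∀ c : ℝ, 0 < c → ∀ s ∈ S, c • s ∈ S)
    {c : ℝ} (hc : 0 < c) {t : V} (ht : t ∈ translates S) : c • t ∈ translates S := by
  obtain ⟨w, hw, s, hs, rfl⟩ := mem_translates.1 ht
  exact mem_translates.2 ⟨w, hw, c • s, hS c hc s hs, map_smul w c s⟩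

theorem sigma_mem_W (i : Fin 4) : sigma i ∈ W := Subgroup.subset_closure ⟨i, rfl⟩

theorem sigma_sigma (i : Fin 4) (s : V) : sigma i (sigma i s) = s :=
  Module.involutive_reflection (pairing_simpleRoot i) s

theorem continuous_apply_equiv (w : V ≃ₗ[ℝ] V) : Continuous w :=
  LinearMap.continuous_of_finiteDimensional w.toLinearMap

theorem sum_sigma (i : Fin 4) (s : V) : ∑ j, sigma i s j = ∑ j, s j + 4 * s i := by
  simp only [sigma_apply, Fin.sum_univ_four]
  fin_cases i <;> simp <;> ring

/-! ### The Tits cone and its bounding cone -/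

/-- The closed simplicial cone of vectors with nonnegative coordinates. -/
def chamber : Set V := {s | ∀ i, 0 ≤ s i}

/-- The Tits cone: the union of the translates of the closed chamber. -/
def titsCone : Set V := translates chamber

/-- The closed cone on which all sums of two distinct coordinates are nonnegative. -/
def pairCone : Set V := {s | ∀ i j, i ≠ j → 0 ≤ s i + s j}

theorem isClosed_pairCone : IsClosed pairCone := by
  simp only [pairCone, Set.ofPred_forall]
  refine isClosed_iInter fun i => isClosed_iInter fun j => isClosed_iInter fun _ => ?_
  exact isClosed_le continuous_const ((continuous_apply i).add (continuous_apply j))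

/-- A sum involving coordinate `k` becomes another such sum, `s j + s k`; the remaining sums
increase by `4 * s k`. -/
theorem sigma_mem_pairCone {s : V} (hs : s ∈ pairCone) {k : Fin 4} (hk : 0 ≤ s k) :
    sigma k s ∈ pairCone := by
  intro i j hij
  rw [sigma_apply, sigma_apply]
  split_ifs with hi hj hj
  · exact absurd (hi.trans hj.symm) hij
  · have := hs j k hj; linarith
  · have := hs i k hi; linarith
  · have := hs i j hij; linarith

/-- The vectors obtained from the closed chamber by successive simple reflections in nonnegative
coordinates. -/
inductive Ascending : V → Prop
  | base (s : V) (hs : s ∈ chamber) : Ascending s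
  | step (s : V) (k : Fin 4) (hs : Ascending s) (hk : 0 ≤ s k) : Ascending (sigma k s)

theorem Ascending.mem_pairCone {s : V} (hs : Ascending s) : s ∈ pairCone := by
  induction hs with
  | base s hs => exact fun i j _ => add_nonneg (hs i) (hs j)
  | step s k _ hk ih => exact sigma_mem_pairCone ih hk

/-- Only reflection in a negative coordinate needs an argument. After a step in `l` coordinate `l`
is nonpositive, so by `pairCone` no other coordinate is negative: the reflection undoes that step.
-/
theorem Ascending.sigma {s : V} (hs : Ascending s) (k : Fin 4) :
    Ascending (Apollonian.sigma k s) := by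
  rcases le_or_gt 0 (s k) with hk | hk
  · exact .step s k hs hk
  · induction hs with
    | base s hs => exact absurd (hs k) hk.not_ge
    | step s l hs hl ih =>
      by_cases hkl : k = l
      · subst hkl
        rwa [sigma_sigma]
      · have h := (Ascending.step s l hs hl).mem_pairCone k l hkl
        rw [sigma_apply l s l, if_pos rfl] at h
        linarith

theorem Ascending.apply {s : V} (hs : Ascending s) {w : V ≃ₗ[ℝ] V} (hw : w ∈ W) :
    Ascending (w s) := by
  induction hw using Subgroup.closure_induction'' generalizing s with
  | mem w hw => obtain ⟨i, rfl⟩ := hw; exact hs.sigma i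
  | inv_mem w hw =>
    obtain ⟨i, rfl⟩ := hw
    have : (Apollonian.sigma i)⁻¹ = Apollonian.sigma i :=
      inv_eq_of_mul_eq_one_left (LinearEquiv.ext (sigma_sigma i))
    rw [this]
    exact hs.sigma i
  | one => exact hs
  | mul x y _ _ hx hy => exact hx (hy hs)

theorem titsCone_subset_pairCone : titsCone ⊆ pairCone := by
  intro t ht
  obtain ⟨w, hw, s, hs, rfl⟩ := mem_translates.1 ht
  exact ((Ascending.base s hs).apply hw).mem_pairCone

theorem A_subset_titsCone : A ⊆ titsCone := translates_mono fun _ hs => hs.1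

theorem twoSkeleton_subset_titsCone : twoSkeleton ⊆ titsCone := translates_mono fun _ hs => hs.1

theorem mem_A_or_mem_twoSkeleton {s : V} (h : s ∈ titsCone) : s ∈ A ∨ s ∈ twoSkeleton := by
  obtain ⟨w, hw, s, hs, rfl⟩ := mem_translates.1 h
  by_cases h : ∀ i j, s i = 0 → s j = 0 → i = j
  · exact Or.inl (mem_translates.2 ⟨w, hw, s, ⟨hs, h⟩, rfl⟩)
  · push Not at h
    obtain ⟨i, j, hi, hj, hij⟩ := h
    exact Or.inr (mem_translates.2 ⟨w, hw, s, ⟨hs, i, j, hij, hi, hj⟩, rfl⟩)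

theorem closure_A_subset_pairCone : closure A ⊆ pairCone :=
  closure_minimal (A_subset_titsCone.trans titsCone_subset_pairCone) isClosed_pairCone

/-! ### Openness of `A` and the forward inclusion -/

/-- A neighbourhood of any point of `C` consists of points `s` such that `s` or some `σ i s`
lies in `C`. -/
theorem A_mem_nhds_of_mem_C {s : V} (hs : s ∈ C) : A ∈ nhds s := by
  -- `i` is the vanishing coordinate if there is one, and arbitrary otherwise.
  obtain ⟨i, hi⟩ : ∃ i, ∀ j, j ≠ i → 0 < s j := by
    by_cases h : ∃ i, s i = 0
    · obtain ⟨i, hi⟩ := h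
      exact ⟨i, fun j hj => lt_of_le_of_ne (hs.1 j) fun e => hj (hs.2 j i e.symm hi)⟩
    · push Not at h
      exact ⟨0, fun j _ => lt_of_le_of_ne (hs.1 j) (h j).symm⟩
  have h₁ : ∀ᶠ t : V in nhds s, ∀ j, j ≠ i → 0 < t j := by
    refine Filter.eventually_all.2 fun j => ?_
    by_cases hj : j = i
    · simp [hj]
    · filter_upwards [(continuous_apply j).continuousAt.eventually_const_lt (hi j hj)] with t ht _
      exact ht
  have h₂ : ∀ᶠ t : V in nhds s, ∀ j, j ≠ i → 0 < t j + 2 * t i := by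
    refine Filter.eventually_all.2 fun j => ?_
    by_cases hj : j = i
    · simp [hj]
    · have hc : Continuous fun t : V => t j + 2 * t i := by fun_prop
      have : 0 < s j + 2 * s i := by linarith [hi j hj, hs.1 i]
      filter_upwards [hc.continuousAt.eventually_const_lt this] with t ht _
      exact ht
  have mem_C : ∀ t : V, 0 ≤ t i → (∀ j, j ≠ i → 0 < t j) → t ∈ C := fun t h0 h => by
    refine ⟨fun j => ?_, fun j k hj hk => ?_⟩
    · by_cases hj : j = i
      · exact hj ▸ h0
      · exact (h j hj).le
    · have : ∀ l, t l = 0 → l = i := fun l hl => by_contra fun hne => (h l hne).ne' hl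
      rw [this j hj, this k hk]
  filter_upwards [h₁, h₂] with t ht₁ ht₂
  rcases le_or_gt 0 (t i) with h0 | h0
  · exact subset_translates C (mem_C t h0 ht₁)
  · refine mem_translates_of_apply (sigma_mem_W i) (subset_translates C (mem_C _ ?_ fun j hj => ?_))
    · rw [sigma_apply, if_pos rfl]
      linarith
    · rw [sigma_apply, if_neg hj]
      exact ht₂ j hj

theorem isOpen_A : IsOpen A := by
  refine isOpen_iff_mem_nhds.2 fun t ht => ?_
  obtain ⟨w, hw, s, hs, rfl⟩ := mem_translates.1 ht
  have h : Filter.Tendsto (w⁻¹ : V ≃ₗ[ℝ] V) (nhds (w s)) (nhds s) := by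
    have := (continuous_apply_equiv w⁻¹).tendsto (w s)
    rwa [inv_apply_apply] at this
  filter_upwards [h (A_mem_nhds_of_mem_C hs)] with t ht
  exact mem_translates_of_apply (W.inv_mem hw) ht

theorem apply_mem_closure_A {s : V} (hs : s ∈ closure A) {w : V ≃ₗ[ℝ] V} (hw : w ∈ W) :
    w s ∈ closure A :=
  map_mem_closure (continuous_apply_equiv w) hs fun _ ht => apply_mem_translates hw ht

theorem threePosOneNeg_of_mem_frontier {s : V} (hs : s ∈ frontier A) (hs' : s ∉ twoSkeleton)
    {w : V ≃ₗ[ℝ] V} (hw : w ∈ W) : ThreePosOneNeg (w s) := by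
  rw [isOpen_A.frontier_eq] at hs
  have hT : s ∉ titsCone := fun h => (mem_A_or_mem_twoSkeleton h).elim hs.2 hs'
  have hF : w s ∉ chamber := fun h =>
    hT (mem_translates_of_apply hw (subset_translates chamber h))
  obtain ⟨i, hi⟩ : ∃ i, w s i < 0 := by simpa [chamber] using hF
  refine ⟨i, hi, fun j hj => ?_⟩
  have := closure_A_subset_pairCone (apply_mem_closure_A hs.1 hw) j i hj
  linarith

/-! ### Points of `B` are limits of points of `A` -/

theorem apply_mem_B {s : V} (hs : s ∈ B) {w : V ≃ₗ[ℝ] V} (hw : w ∈ W) : w s ∈ B :=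
  fun u hu => hs (u * w) (W.mul_mem hu hw)

theorem threePosOneNeg_of_mem_B {s : V} (hs : s ∈ B) : ThreePosOneNeg s := hs 1 W.one_mem

theorem notMem_titsCone_of_mem_B {s : V} (hs : s ∈ B) : s ∉ titsCone := by
  intro h
  obtain ⟨w, hw, t, ht, rfl⟩ := mem_translates.1 h
  obtain ⟨i, hi, -⟩ := threePosOneNeg_of_mem_B (apply_mem_B hs (W.inv_mem hw))
  rw [inv_apply_apply] at hi
  exact (ht i).not_gt hi

/-- Translating by the powers of `σ j * σ i` with `s i + s j < 0` and `s i < 0` makes every other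
coordinate tend to `-∞`. -/
theorem exists_translate_le {s : V} {i j k : Fin 4} (hij : i ≠ j) (hki : k ≠ i) (hkj : k ≠ j)
    (hi : s i < 0) (hc : s i + s j < 0) (n : ℕ) :
    ∃ w ∈ W, w s i < 0 ∧ w s i + w s j = s i + s j ∧ w s k ≤ s k + 2 * n * (s i + s j) := by
  induction n with
  | zero => exact ⟨1, W.one_mem, hi, rfl, by simp⟩
  | succ n ih =>
    obtain ⟨w, hw, h₁, h₂, h₃⟩ := ih
    -- With `c = s i + s j`, the product fixes `c`, sends `s i` to `s i + 2 * c` and `s k` to `s k +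
    -- 2 * c + 4 * s i`.
    refine ⟨sigma j * (sigma i * w), W.mul_mem (sigma_mem_W j) (W.mul_mem (sigma_mem_W i) hw), ?_⟩
    simp only [LinearEquiv.mul_apply, sigma_apply, hij, hij.symm, hki, hkj, if_true, if_false]
    push_cast
    refine ⟨?_, ?_, ?_⟩ <;> linarith

/-- If the negative coordinate had a negative sum with another one, some translate would have two
negative coordinates. -/
theorem sum_nonneg_of_mem_B {s : V} (hs : s ∈ B) : 0 ≤ ∑ i, s i := by
  obtain ⟨i, hi, hpos⟩ := threePosOneNeg_of_mem_B hs
  have key : ∀ j, j ≠ i → 0 ≤ s i + s j := by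
    intro j hj
    by_contra! hc
    obtain ⟨k, hki, hkj⟩ : ∃ k : Fin 4, k ≠ i ∧ k ≠ j := by
      have : ∀ i j : Fin 4, ∃ k, k ≠ i ∧ k ≠ j := by decide
      exact this i j
    -- This `n` makes `s k + 2 * n * (s i + s j)` negative.
    obtain ⟨n, hn⟩ := exists_nat_gt (s k / (-2 * (s i + s j)))
    rw [div_lt_iff₀ (by linarith)] at hn
    obtain ⟨w, hw, h₁, -, h₃⟩ := exists_translate_le hj.symm hki hkj hi hc n
    obtain ⟨l, -, hl⟩ := hs w hw
    have hil : i = l := by_contra fun h => (hl i h).not_gt h₁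
    have := hl k (hil ▸ hki)
    linarith
  obtain ⟨j, hj⟩ := exists_ne i
  rw [← Finset.add_sum_erase _ _ (Finset.mem_univ i),
    ← Finset.add_sum_erase _ _ (Finset.mem_erase.2 ⟨hj, Finset.mem_univ j⟩), ← add_assoc]
  refine add_nonneg (key j hj) (Finset.sum_nonneg fun k hk => (hpos k ?_).le)
  exact (Finset.mem_erase.1 (Finset.mem_erase.1 hk).2).1

/-- The vector with all coordinates `1`, in the interior of the chamber. -/
def rho : V := fun _ => 1

/-- Descent: reflecting `x` successively in its negative coordinates either reaches the chamber, or
continues for `n` steps, in which case the height of the translates of `rho` grows. -/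
theorem mem_titsCone_or_exists_descent (x : V) (n : ℕ) :
    x ∈ titsCone ∨ ∃ w ∈ W, ∃ i, 0 ≤ w x i ∧ ∑ j, w x j ≤ ∑ j, x j ∧ w rho i ≤ -1 ∧
      (∀ j, j ≠ i → 0 ≤ w rho i + w rho j) ∧ 4 * (n : ℝ) ≤ ∑ j, w rho j := by
  have step : ∀ w ∈ W, x ∉ titsCone → ∃ i, w x i < 0 := fun w hw hx => by
    have hF : w x ∉ chamber := fun h =>
      hx (mem_translates_of_apply hw (subset_translates chamber h))
    simpa [chamber] using hF
  by_cases hx : x ∈ titsCone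
  · exact Or.inl hx
  right
  induction n with
  | zero =>
    obtain ⟨i, hi⟩ := step 1 W.one_mem hx
    change x i < 0 at hi
    refine ⟨sigma i, sigma_mem_W i, i, ?_, ?_, ?_, fun j hj => ?_, ?_⟩
    · rw [sigma_apply, if_pos rfl]; linarith
    · rw [sum_sigma]; linarith
    · simp [sigma_apply, rho]
    · simp only [sigma_apply, rho, if_true, if_neg hj]; norm_num
    · rw [sum_sigma]; simp [rho]
  | succ n ih =>
    obtain ⟨w, hw, i, h₁, h₂, h₃, h₄, h₅⟩ := ih
    obtain ⟨k, hk⟩ := step w hw hx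
    -- The coordinate just reflected is nonnegative, so the next one differs; there `w rho` is at
    -- least `1`, and its height gains at least `4`.
    have hki : k ≠ i := by rintro rfl; exact h₁.not_gt hk
    have hrk := h₄ k hki
    refine ⟨sigma k * w, W.mul_mem (sigma_mem_W k) hw, k, ?_, ?_, ?_, fun j hj => ?_, ?_⟩
    · rw [LinearEquiv.mul_apply, sigma_apply, if_pos rfl]; linarith
    · simp only [LinearEquiv.mul_apply]; rw [sum_sigma]; linarith
    · rw [LinearEquiv.mul_apply, sigma_apply, if_pos rfl]; linarith
    · simp only [LinearEquiv.mul_apply, sigma_apply, if_true, if_neg hj]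
      by_cases hji : j = i
      · subst hji; linarith
      · have := h₄ j hji; linarith
    · simp only [LinearEquiv.mul_apply]; rw [sum_sigma]; push_cast; linarith

/-- Translates of `s` have nonnegative height, so `n` descent steps force `4 * n * δ` to be at most
the height of `s + δ • rho`. -/
theorem add_smul_rho_mem_titsCone {s : V} (hs : s ∈ B) {δ : ℝ} (hδ : 0 < δ) :
    s + δ • rho ∈ titsCone := by
  obtain ⟨n, hn⟩ := exists_nat_gt ((∑ j, (s + δ • rho) j) / (4 * δ))
  rw [div_lt_iff₀ (by positivity)] at hn
  rcases mem_titsCone_or_exists_descent (s + δ • rho) n with h | ⟨w, hw, -, -, h₂, -, -, h₅⟩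
  · exact h
  · have h := sum_nonneg_of_mem_B (apply_mem_B hs hw)
    have e : ∑ j, w (s + δ • rho) j = ∑ j, w s j + δ * ∑ j, w rho j := by
      simp [Finset.sum_add_distrib, Finset.mul_sum]
    have := mul_le_mul_of_nonneg_left h₅ hδ.le
    linarith

theorem mem_closure_of_add_smul {S : Set V} {s r : V} (h : ∀ δ : ℝ, 0 < δ → s + δ • r ∈ S) :
    s ∈ closure S := by
  have hc : Continuous fun δ : ℝ => s + δ • r := by fun_prop
  have ht : Filter.Tendsto (fun δ : ℝ => s + δ • r) (nhdsWithin 0 (Set.Ioi 0)) (nhds s) := by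
    have := hc.tendsto 0
    simp only [zero_smul, add_zero] at this
    exact this.mono_left nhdsWithin_le_nhds
  exact mem_closure_of_tendsto ht (by filter_upwards [self_mem_nhdsWithin] with δ hδ using h δ hδ)

theorem titsCone_subset_closure_A : titsCone ⊆ closure A := by
  intro t ht
  obtain ⟨w, hw, s, hs, rfl⟩ := mem_translates.1 ht
  refine apply_mem_closure_A (mem_closure_of_add_smul (r := rho) fun δ hδ => ?_) hw
  have hpos : ∀ i, 0 < (s + δ • rho) i := fun i => by
    have := hs i
    simp only [rho, Pi.add_apply, Pi.smul_apply, smul_eq_mul, mul_one]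
    linarith
  exact subset_translates C ⟨fun i => (hpos i).le, fun i _ hi => absurd hi (hpos i).ne'⟩

theorem B_eq_frontier_diff : B = frontier A \ twoSkeleton := by
  ext s
  refine ⟨fun hs => ?_, fun hs w hw => threePosOneNeg_of_mem_frontier hs.1 hs.2 hw⟩
  have hT := notMem_titsCone_of_mem_B hs
  refine ⟨?_, fun h => hT (twoSkeleton_subset_titsCone h)⟩
  rw [isOpen_A.frontier_eq]
  refine ⟨?_, fun h => hT (A_subset_titsCone h)⟩
  rw [← closure_closure]
  exact closure_mono titsCone_subset_closure_A
    (mem_closure_of_add_smul fun δ hδ => add_smul_rho_mem_titsCone hs hδ)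

/-! ### Projective space -/

/-- The height is the sum of two complementary pair sums, so all six pair sums vanish. -/
theorem eq_zero_of_mem_pairCone_of_sum_nonpos {s : V} (hs : s ∈ pairCone) (h : ∑ i, s i ≤ 0) :
    s = 0 := by
  rw [Fin.sum_univ_four] at h
  have h01 := hs 0 1 (by decide)
  have h02 := hs 0 2 (by decide)
  have h03 := hs 0 3 (by decide)
  have h12 := hs 1 2 (by decide)
  have h13 := hs 1 3 (by decide)
  have h23 := hs 2 3 (by decide)
  ext i
  fin_cases i <;> simp <;> linarith

theorem sum_nonneg_of_mem_pairCone {s : V} (hs : s ∈ pairCone) : 0 ≤ ∑ i, s i := by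
  rw [Fin.sum_univ_four]
  linarith [hs 0 1 (by decide), hs 2 3 (by decide)]

theorem eq_zero_of_mem_pairCone_of_neg_mem {s : V} (hs : s ∈ pairCone) (hs' : -s ∈ pairCone) :
    s = 0 := by
  refine eq_zero_of_mem_pairCone_of_sum_nonpos hs ?_
  have := sum_nonneg_of_mem_pairCone hs'
  simp only [Pi.neg_apply, Finset.sum_neg_distrib] at this
  linarith

theorem mk_mem_proj_iff {S : Set V} (hS : ∀ c : ℝ, 0 < c → ∀ s ∈ S, c • s ∈ S) {v : V}
    (hv : v ≠ 0) : Projectivization.mk ℝ v hv ∈ proj S ↔ v ∈ S ∨ -v ∈ S := by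
  constructor
  · rintro ⟨u, hu, huS, h⟩
    obtain ⟨c, rfl⟩ := (Projectivization.mk_eq_mk_iff' ℝ u v hu hv).1 h
    rcases lt_trichotomy c 0 with hc | rfl | hc
    · right
      have := hS (-c)⁻¹ (by simpa using hc) _ huS
      rwa [smul_smul, inv_neg, neg_mul, inv_mul_cancel₀ hc.ne, neg_one_smul] at this
    · simp at hu
    · left
      have := hS c⁻¹ (by simpa using hc) _ huS
      rwa [smul_smul, inv_mul_cancel₀ hc.ne', one_smul] at this
  · rintro (h | h)
    · exact ⟨v, hv, h, rfl⟩
    · exact ⟨-v, neg_ne_zero.2 hv, h, (Projectivization.mk_eq_mk_iff' ℝ _ _ _ _).2 ⟨-1, by simp⟩⟩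

theorem mk_neg (v : V) (hv : v ≠ 0) (hv' : -v ≠ 0) :
    Projectivization.mk ℝ (-v) hv' = Projectivization.mk ℝ v hv :=
  (Projectivization.mk_eq_mk_iff' ℝ _ _ _ _).2 ⟨-1, by simp⟩

theorem smul_mem_A {c : ℝ} (hc : 0 < c) (s : V) (hs : s ∈ A) : c • s ∈ A := by
  refine smul_mem_translates (S := C)
    (fun c hc s hs => ⟨fun i => ?_, fun i j hi hj => ?_⟩) hc hs
  · exact mul_nonneg hc.le (hs.1 i)
  · exact hs.2 i j (by simpa [hc.ne'] using hi) (by simpa [hc.ne'] using hj)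

theorem smul_mem_twoSkeleton {c : ℝ} (hc : 0 < c) (s : V) (hs : s ∈ twoSkeleton) :
    c • s ∈ twoSkeleton := by
  refine smul_mem_translates (S := baseTwoSkeleton)
    (fun c hc s hs => ⟨fun i => ?_, ?_⟩) hc hs
  · exact mul_nonneg hc.le (hs.1 i)
  · obtain ⟨i, j, hij, hi, hj⟩ := hs.2
    exact ⟨i, j, hij, by simp [hi], by simp [hj]⟩

theorem smul_mem_closure_A {c : ℝ} (hc : 0 < c) (s : V) (hs : s ∈ closure A) :
    c • s ∈ closure A :=
  map_mem_closure (continuous_const_smul c) hs (smul_mem_A hc)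

theorem zero_notMem_A : (0 : V) ∉ A := by
  intro h
  obtain ⟨w, -, s, hs, h0⟩ := mem_translates.1 h
  obtain rfl : s = 0 := by simpa using h0
  exact absurd (hs.2 0 1 rfl rfl) (by decide)

theorem continuous_mk' : Continuous (Projectivization.mk' ℝ : {v : V // v ≠ 0} → RP3) :=
  continuous_coinduced_rng

theorem isOpen_proj_A : IsOpen (proj A) := by
  refine isOpen_coinduced.2 ?_
  have : (Projectivization.mk' ℝ : {v : V // v ≠ 0} → RP3) ⁻¹' proj A
      = {v : {v : V // v ≠ 0} | (v : V) ∈ A} ∪ {v | -(v : V) ∈ A} := by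
    ext v
    exact mk_mem_proj_iff (fun c hc => smul_mem_A hc) v.2
  rw [this]
  exact (isOpen_A.preimage continuous_subtype_val).union
    (isOpen_A.preimage continuous_subtype_val.neg)

theorem isClosed_proj_closure_A : IsClosed (proj (closure A)) := by
  refine isClosed_coinduced.2 ?_
  have : (Projectivization.mk' ℝ : {v : V // v ≠ 0} → RP3) ⁻¹' proj (closure A)
      = {v : {v : V // v ≠ 0} | (v : V) ∈ closure A} ∪
        {v | -(v : V) ∈ closure A} := by
    ext v
    exact mk_mem_proj_iff (fun c hc => smul_mem_closure_A hc) v.2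
  rw [this]
  exact (isClosed_closure.preimage continuous_subtype_val).union
    (isClosed_closure.preimage continuous_subtype_val.neg)

theorem closure_proj_A : closure (proj A) = proj (closure A) := by
  refine (closure_minimal ?_ isClosed_proj_closure_A).antisymm ?_
  · rintro _ ⟨v, hv, h, rfl⟩
    exact ⟨v, hv, subset_closure h, rfl⟩
  · rintro _ ⟨v, hv, h, rfl⟩
    -- Removing the origin does not change the closure at `v`, since `0 ∉ A`.
    have hcl : (⟨v, hv⟩ : {v : V // v ≠ 0}) ∈
        closure {v : {v : V // v ≠ 0} | (v : V) ∈ A} := by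
      rw [closure_subtype]
      convert h
      ext u
      constructor
      · rintro ⟨u, hu, rfl⟩
        exact hu
      · exact fun hu => ⟨⟨u, fun h0 => zero_notMem_A (h0 ▸ hu)⟩, hu, rfl⟩
    exact map_mem_closure continuous_mk' hcl fun u hu => ⟨u, u.2, hu, rfl⟩

/-- For `u ≠ 0`, `u ∈ closure A` excludes `-u ∈ A`, so the two opposite cones do not interfere. -/
theorem mk_mem_frontier_proj_A_iff {v : V} (hv : v ≠ 0) :
    Projectivization.mk ℝ v hv ∈ frontier (proj A) ↔ v ∈ frontier A ∨ -v ∈ frontier A := by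
  have aux : ∀ u : V, u ≠ 0 → u ∈ closure A → -u ∉ A := fun u hu h h' =>
    hu (eq_zero_of_mem_pairCone_of_neg_mem (closure_A_subset_pairCone h)
      (closure_A_subset_pairCone (subset_closure h')))
  have h₁ := aux v hv
  have h₂ := aux (-v) (neg_ne_zero.2 hv)
  rw [neg_neg] at h₂
  rw [isOpen_proj_A.frontier_eq, isOpen_A.frontier_eq, closure_proj_A, Set.mem_sdiff,
    mk_mem_proj_iff (fun c hc => smul_mem_closure_A hc),
    mk_mem_proj_iff (fun c hc => smul_mem_A hc), Set.mem_sdiff, Set.mem_sdiff]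
  tauto

theorem mem_frontier_A_of_mk_mem {v : V} (hv : v ≠ 0) (hsum : 0 ≤ ∑ i, v i)
    (h : Projectivization.mk ℝ v hv ∈ frontier (proj A)) : v ∈ frontier A := by
  refine ((mk_mem_frontier_proj_A_iff hv).1 h).resolve_right fun h' => hv ?_
  refine neg_eq_zero.1 (eq_zero_of_mem_pairCone_of_sum_nonpos
    (closure_A_subset_pairCone (frontier_subset_closure h')) ?_)
  simpa using hsum

theorem notMem_twoSkeleton_of_mk_notMem {v : V} (hv : v ≠ 0)
    (h : Projectivization.mk ℝ v hv ∉ proj twoSkeleton) : v ∉ twoSkeleton :=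
  fun h' => h ⟨v, hv, h', rfl⟩

theorem mem_B_of_mk_mem {v : V} (hv : v ≠ 0) (hsum : 0 ≤ ∑ i, v i)
    (h : Projectivization.mk ℝ v hv ∈ frontier (proj A))
    (h' : Projectivization.mk ℝ v hv ∉ proj twoSkeleton) : v ∈ B := by
  rw [B_eq_frontier_diff]
  exact ⟨mem_frontier_A_of_mk_mem hv hsum h, notMem_twoSkeleton_of_mk_notMem hv h'⟩

theorem proj_B_eq_frontier_diff : proj B = frontier (proj A) \ proj twoSkeleton := by
  ext p
  constructor
  · rintro ⟨v, hv, hB, rfl⟩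
    rw [B_eq_frontier_diff] at hB
    refine ⟨(mk_mem_frontier_proj_A_iff hv).2 (Or.inl hB.1), ?_⟩
    rw [mk_mem_proj_iff (fun c hc => smul_mem_twoSkeleton hc)]
    rintro (h | h)
    · exact hB.2 h
    · exact hv (eq_zero_of_mem_pairCone_of_neg_mem
        (closure_A_subset_pairCone (frontier_subset_closure hB.1))
        (titsCone_subset_pairCone (twoSkeleton_subset_titsCone h)))
  · induction p using Projectivization.ind with
    | h v hv =>
      rintro ⟨h, h'⟩
      rcases le_total 0 (∑ i, v i) with hsum | hsum
      · exact ⟨v, hv, mem_B_of_mk_mem hv hsum h h', rfl⟩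
      · have hv' : -v ≠ 0 := neg_ne_zero.2 hv
        rw [← mk_neg v hv hv'] at h h' ⊢
        exact ⟨-v, hv', mem_B_of_mk_mem hv' (by simpa using hsum) h h', rfl⟩

end Apollonian

/-- First in `ℝ⁴`, for the cone `A` itself; then in `ℝP³`, for the projectivization of `A`, where a
point is represented by its vectors `v` of nonnegative height `∑ i, v i`. -/
theorem proposition5p4 :
    ((∀ s : Apollonian.V, s ∈ frontier Apollonian.A → s ∉ Apollonian.twoSkeleton →
        ∀ w ∈ Apollonian.W, Apollonian.ThreePosOneNeg (w s)) ∧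
      Apollonian.B = frontier Apollonian.A \ Apollonian.twoSkeleton) ∧
    ((∀ (v : Apollonian.V) (hv : v ≠ 0), 0 ≤ ∑ i, v i →
        Projectivization.mk ℝ v hv ∈ frontier (Apollonian.proj Apollonian.A) →
        Projectivization.mk ℝ v hv ∉ Apollonian.proj Apollonian.twoSkeleton →
        ∀ w ∈ Apollonian.W, Apollonian.ThreePosOneNeg (w v)) ∧
      Apollonian.proj Apollonian.B =
        frontier (Apollonian.proj Apollonian.A) \ Apollonian.proj Apollonian.twoSkeleton) := by
  refine ⟨⟨fun s hs hs' w hw => Apollonian.threePosOneNeg_of_mem_frontier hs hs' hw,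
    Apollonian.B_eq_frontier_diff⟩, fun v hv hsum h h' w hw =>
    Apollonian.mem_B_of_mk_mem hv hsum h h' w hw, Apollonian.proj_B_eq_frontier_diff⟩
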